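/- Let $\alpha$ be a set (for instance the positive integers) and let $\mathfrak{M}$ be the class of all matroids whose ground set is a finite subset of $\alpha$. For a non-empty loopless matroid $\mathsf{M}$ let $\mathcal{L}(\mathsf{M})$ be its lattice of flats, and let $\Delta$ be the order complex of its proper part: the faces of $\Delta$ are the chains (including the empty chain) of flats containing neither the bottom nor the top element of $\mathcal{L}(\mathsf{M})$. The chain polynomial of $\mathsf{M}$ is the $f$-polynomial $$f_{\Delta}(t)=\sum_{i=0}^{d} f_i\,t^{d-i}\in\mathbb{Z}[t],$$ where $f_i$ is the number of faces of $\Delta$ of size $i$ and $d$ is the largest size of a face. **Theorem.** The map $f:\mathfrak{M}\to\mathbb{Z}[t]$ assigning to each non-empty loopless matroid its chain polynomial, and to each matroid that has loops or is empty the zero polynomial, is a valuative invariant. That is: 1. (Invariant) $f(\mathsf{M})=f(\mathsf{N})$ whenever $\mathsf{M},\mathsf{N}\in\mathfrak{M}$ are isomorphic, possibly on different ground sets. 2. (Valuation) For every finite $E\subseteq\alpha$, write $\mathscr{P}(\mathsf{M})\subseteq\mathbb{R}^E$ for the base polytope of a matroid $\mathsf{M}$ on $E$, i.e. the convex hull of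 the indicator vectors of its bases, and let $\mathbb{I}_E$ be the group of functions $\mathbb{R}^E\to\mathbb{Z}$ generated by the indicator functions $1_{\mathscr{P}(\mathsf{M})}$ of the base polytopes of all matroids $\mathsf{M}$ on $E$. Then there is a homomorphism of abelian groups $\widehat f:\mathbb{I}_E\to\mathbb{Z}[t]$ with $f(\mathsf{M})=\widehat f(1_{\mathscr{P}(\mathsf{M})})$ for every matroid $\mathsf{M}$ on $E$. -/

import Mathlib

open Polynomial

namespace ChainPoly

/-! ### Order complexes and `f`-polynomials -/

/-- The faces of the order complex of the proper part of a poset `P`: the finite chains of `P`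
(the empty chain included) that contain neither the bottom nor the top element of `P`. -/
def orderComplex (P : Type*) [PartialOrder P] : Set (Finset P) :=
  {C | IsChain (· ≤ ·) (C : Set P) ∧ ∀ x ∈ C, ¬ IsBot x ∧ ¬ IsTop x}

/-- The number `f_i` of faces of size `i` of a simplicial complex, given by its set of faces. -/
noncomputable def fVector {V : Type*} (Δ : Set (Finset V)) (i : ℕ) : ℕ :=
  {C : Finset V | C ∈ Δ ∧ C.card = i}.ncard

/-- The size `d` of the largest face of a simplicial complex. -/
noncomputable def maxFaceSize {V : Type*} (Δ : Set (Finset V)) : ℕ :=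
  sSup (Finset.card '' Δ)

/-- The `f`-polynomial `∑ i = 0, …, d, f_i x ^ (d - i)` of a simplicial complex. -/
noncomputable def fPolynomial {V : Type*} (Δ : Set (Finset V)) : ℤ[X] :=
  ∑ i ∈ Finset.range (maxFaceSize Δ + 1), C (fVector Δ i : ℤ) * X ^ (maxFaceSize Δ - i)

/-! ### Matroids -/

/-- The matroids whose ground set is a finite subset of `α`. -/
def FinMatroid (α : Type*) := {M : Matroid α // M.Finite}

/-- The flats of a matroid, ordered by inclusion. -/
abbrev Flats {α : Type*} (M : Matroid α) := {F : Set α // M.IsFlat F}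

open Classical in
/-- The map sending a non-empty loopless matroid to its chain polynomial, that is, to the
`f`-polynomial of the order complex of the proper part of its lattice of flats, and sending a
matroid with loops, or the empty matroid, to zero. -/
noncomputable def chainPolynomial {α : Type*} (M : FinMatroid α) : ℤ[X] :=
  if M.1.Loopless ∧ M.1.E.Nonempty then fPolynomial (orderComplex (Flats M.1)) else 0

/-- Two matroids, on possibly different ground sets, are isomorphic if some bijection between
their ground sets identifies their bases. -/
def Isomorphic {α β : Type*} (M : Matroid α) (N : Matroid β) : Prop :=
  ∃ e : M.E ≃ N.E, ∀ B : Set M.E,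
    M.IsBase (Subtype.val '' B) ↔ N.IsBase (Subtype.val '' (e '' B))

/-! ### Valuations -/

/-- The base polytope in `ℝ ^ E` of a matroid `M` with ground set `E`: the convex hull of the
indicator vectors of the bases. -/
def basePolytope {α : Type*} (E : Finset α) (M : Matroid α) : Set (E → ℝ) :=
  convexHull ℝ {x | ∃ B : Set α, M.IsBase B ∧ x = fun i : E => B.indicator (fun _ => (1 : ℝ)) (i : α)}

/-- The family of the base polytopes of all matroids with ground set `E`. -/
def basePolytopes {α : Type*} (E : Finset α) : Set (Set (E → ℝ)) :=
  {P | ∃ M : Matroid α, M.E = (E : Set α) ∧ P = basePolytope E M}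

/-- The integer-valued indicator function of a set. -/
noncomputable def indicatorFun {V : Type*} (P : Set V) : V → ℤ :=
  P.indicator (fun _ => 1)

/-- The indicator subgroup of a family of sets: the group of all integer combinations of the
indicator functions of its members. -/
def indicatorSubgroup {V : Type*} (𝔓 : Set (Set V)) : AddSubgroup (V → ℤ) :=
  AddSubgroup.closure (indicatorFun '' 𝔓)

/-- A map `f` on a family `𝔓` of polytopes is a (strong) valuation if it factors through
`P ↦ indicatorFun P` by a homomorphism from the indicator subgroup. -/
def IsStrongValuation {V A : Type*} [AddCommGroup A] (𝔓 : Set (Set V)) (f : 𝔓 → A) : Prop :=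
  ∃ g : indicatorSubgroup 𝔓 →+ A, ∀ P : 𝔓,
    f P = g ⟨indicatorFun P.1, AddSubgroup.subset_closure (Set.mem_image_of_mem _ P.2)⟩

/-- A map on matroids is a valuation if, for every finite ground set `E`, its restriction to the
matroids with ground set `E`, seen as a map on their base polytopes, is a valuation. -/
def IsValuation {α A : Type*} [AddCommGroup A] (f : FinMatroid α → A) : Prop :=
  ∀ E : Finset α, ∃ F : basePolytopes E → A, IsStrongValuation (basePolytopes E) F ∧
    ∀ (M : FinMatroid α) (hM : M.1.E = (E : Set α)),
      F ⟨basePolytope E M.1, M.1, hM, rfl⟩ = f M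

/-- A map on matroids is an invariant if it takes the same value on isomorphic matroids. -/
def IsInvariant {α A : Type*} (f : FinMatroid α → A) : Prop :=
  ∀ M N : FinMatroid α, Isomorphic M.1 N.1 → f M = f N

/-- A valuative invariant is a map on matroids that is both an invariant and a valuation. -/
def IsValuativeInvariant {α A : Type*} [AddCommGroup A] (f : FinMatroid α → A) : Prop :=
  IsInvariant f ∧ IsValuation f

end ChainPoly

namespace ChainPoly

/-!
Every integer relation between indicator functions of compact convex sets is inherited by their
Euler characteristics (by induction on the dimension, slicing by hyperplanes), and hence by their
faces in a fixed direction. A chain `C` of sets cuts out the face of the base polytope of a matroid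
on which the sums of the coordinates in the members of `C` are maximal; its vertices are the bases
which restrict to bases of all members of `C`. This face contains a point with positive coordinates
if and only if the matroid has no loops and `C` consists of flats: an element of the closure of
`F ∈ C` outside `F`, like a loop, lies in none of these bases. So the condition on `C` is the Euler
characteristic of a face intersected with the positive orthant, and is valuative. The chain
polynomial is the sum of the monomials `t ^ (r - 1 - |C|)` over the chains `C` of proper nonempty
flats, and a relation can be split according to the rank `r`, as base polytopes of matroids of
different ranks are disjoint.
-/

open Set Filter Topology Metric

section Valuative

variable {ι V W A B : Type*} [AddCommGroup A] [AddCommGroup B] {P : ι → Set V}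

/-- A map `f` on the index set of a family `P` of sets is valuative if every integer relation
between the indicator functions of the `P i` also holds between the values `f i`. This is
`IsStrongValuation` for indexed families, stated through kernels so that it can be checked one
relation at a time. -/
def IsValuative (P : ι → Set V) (f : ι → A) : Prop :=
  ∀ (s : Finset ι) (a : ι → ℤ), ∑ i ∈ s, a i • indicatorFun (P i) = 0 → ∑ i ∈ s, a i • f i = 0

namespace IsValuative

theorem zero (P : ι → Set V) : IsValuative P fun _ => (0 : A) := fun s a _ => by
  simp only [smul_zero, Finset.sum_const_zero]

theorem indicatorFun_apply (P : ι → Set V) (x : V) :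
    IsValuative P fun i => indicatorFun (P i) x := fun s a h => by
  simpa only [Finset.sum_apply, Pi.smul_apply, Pi.zero_apply] using congrFun h x

theorem sub {f g : ι → A} (hf : IsValuative P f) (hg : IsValuative P g) :
    IsValuative P fun i => f i - g i := fun s a h => by
  simp only [smul_sub, Finset.sum_sub_distrib, hf s a h, hg s a h, sub_zero]

theorem finsum {κ : Type*} {f : κ → ι → A} (hf : ∀ k, IsValuative P (f k))
    (hfin : ∀ i, (Function.support fun k => f k i).Finite) :
    IsValuative P fun i => ∑ᶠ k, f k i := fun s a h => by
  have hfin' : ∀ i, (Function.support fun k => a i • f k i).Finite := fun i =>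
    (hfin i).subset fun k hk hfk => hk (by simp only [hfk, smul_zero])
  simp only [smul_finsum' _ (hfin _)]
  rw [← finsum_sum_comm s (fun k i => a i • f k i) fun i _ => hfin' i]
  simp only [hf _ s a h, finsum_zero]

theorem of_eventually {T : Type*} {l : Filter T} [l.NeBot] {f : T → ι → A} {g : ι → A}
    (hf : ∀ t, IsValuative P (f t)) (h : ∀ i, ∀ᶠ t in l, f t i = g i) : IsValuative P g :=
  fun s a ha => by
    obtain ⟨t, ht⟩ := ((Filter.eventually_all_finset s).2 fun i _ => h i).exists
    rw [← hf t s a ha]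
    exact Finset.sum_congr rfl fun i hi => by rw [ht i hi]

theorem trans {Q : ι → Set W} {f : ι → A} (hf : IsValuative Q f)
    (hQ : ∀ y, IsValuative P fun i => indicatorFun (Q i) y) : IsValuative P f :=
  fun s a h => hf s a <| funext fun y => by
    simpa only [Finset.sum_apply, Pi.smul_apply, Pi.zero_apply] using hQ y s a h

/-- A relation between indicator functions is the sum of its parts on the classes of a parameter
that is constant on intersecting members, as those parts have disjoint supports. -/
theorem map_of_eq_of_inter_nonempty {κ : Type*} {f : ι → A} (hf : IsValuative P f) {ρ : ι → κ}
    (hρ : ∀ i j, (P i ∩ P j).Nonempty → ρ i = ρ j) (g : κ → A →+ B) :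
    IsValuative P fun i => g (ρ i) (f i) := fun s a h => by
  classical
  have hclass : ∀ r, ∑ i ∈ s with ρ i = r, a i • indicatorFun (P i) = 0 := by
    intro r
    funext x
    simp only [Finset.sum_apply, Pi.smul_apply, Pi.zero_apply]
    by_cases hx : ∃ i, ρ i = r ∧ x ∈ P i
    · obtain ⟨i, rfl, hxi⟩ := hx
      rw [Finset.sum_filter_of_ne fun j _ hj => ?_]
      · exact indicatorFun_apply P x s a h
      · refine hρ j i ⟨x, of_not_not fun hxj => hj ?_, hxi⟩
        rw [indicatorFun, indicator_of_notMem hxj, smul_zero]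
    · refine Finset.sum_eq_zero fun i hi => ?_
      rw [indicatorFun, indicator_of_notMem fun hxi => hx ⟨i, (Finset.mem_filter.1 hi).2, hxi⟩,
        smul_zero]
  rw [← Finset.sum_fiberwise_of_maps_to fun i hi => Finset.mem_image_of_mem ρ hi]
  refine Finset.sum_eq_zero fun r _ => ?_
  calc ∑ i ∈ s with ρ i = r, a i • g (ρ i) (f i)
      = g r (∑ i ∈ s with ρ i = r, a i • f i) := by
        rw [map_sum]
        exact Finset.sum_congr rfl fun i hi => by rw [map_zsmul, (Finset.mem_filter.1 hi).2]
    _ = 0 := by rw [hf _ a (hclass r), map_zero]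

theorem exists_isStrongValuation {𝔓 : Set (Set V)} (hP : range P = 𝔓) {f : ι → A}
    (hf : IsValuative P f) :
    ∃ F : 𝔓 → A, IsStrongValuation 𝔓 F ∧ ∀ i, F ⟨P i, hP ▸ mem_range_self i⟩ = f i := by
  subst hP
  set v : ι → indicatorSubgroup (range P) := fun i =>
    ⟨indicatorFun (P i), AddSubgroup.subset_closure (mem_image_of_mem _ (mem_range_self i))⟩
  set φ : (ι →₀ ℤ) →+ indicatorSubgroup (range P) :=
    (Finsupp.linearCombination ℤ v).toAddMonoidHom
  set ψ : (ι →₀ ℤ) →+ A := (Finsupp.linearCombination ℤ f).toAddMonoidHom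
  have hφ : Function.Surjective φ := by
    rintro ⟨y, hy⟩
    induction hy using AddSubgroup.closure_induction with
    | mem y hy =>
      obtain ⟨_, ⟨i, rfl⟩, rfl⟩ := hy
      exact ⟨Finsupp.single i 1, by simp [φ, v]⟩
    | zero => exact ⟨0, map_zero φ⟩
    | add y z _ _ hy hz =>
      obtain ⟨⟨b, hb⟩, c, hc⟩ := And.intro hy hz
      exact ⟨b + c, by rw [map_add, hb, hc]; rfl⟩
    | neg y _ hy =>
      obtain ⟨b, hb⟩ := hy
      exact ⟨-b, by rw [map_neg, hb]; rfl⟩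
  have hker : φ.ker ≤ ψ.ker := fun b hb => by
    refine hf b.support b ?_
    have := congrArg Subtype.val (AddMonoidHom.mem_ker.1 hb)
    simpa [φ, v, Finsupp.linearCombination_apply, Finsupp.sum] using this
  set g := φ.liftOfSurjective hφ ⟨ψ, hker⟩
  refine ⟨fun Q => g ⟨indicatorFun Q.1, AddSubgroup.subset_closure (mem_image_of_mem _ Q.2)⟩,
    ⟨g, fun _ => rfl⟩, fun i => ?_⟩
  calc g (v i) = g (φ (Finsupp.single i 1)) := by simp [φ]
    _ = ψ (Finsupp.single i 1) := AddMonoidHom.liftOfRightInverse_comp_apply ..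
    _ = f i := by simp [ψ]

end IsValuative

end Valuative

section EulerCharacteristic

open Classical in
/-- The Euler characteristic of a compact convex set: `1`, or `0` if the set is empty. The value
on other sets carries no meaning. -/
noncomputable def eulerChar {V : Type*} (K : Set V) : ℤ :=
  if K.Nonempty then 1 else 0

theorem indicatorFun_eq_eulerChar {V W : Type*} {P : Set V} {x : V} {K : Set W}
    (h : K.Nonempty ↔ x ∈ P) : indicatorFun P x = eulerChar K := by
  classical
  rw [indicatorFun, indicator_apply, eulerChar]
  exact if_congr h.symm rfl rfl

theorem eulerChar_congr {V W : Type*} {K : Set V} {L : Set W}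
    (h : K.Nonempty ↔ L.Nonempty) : eulerChar K = eulerChar L := by
  classical exact if_congr h rfl rfl

theorem eulerChar_of_nonempty {V : Type*} {K : Set V} (h : K.Nonempty) : eulerChar K = 1 :=
  if_pos h

theorem eulerChar_of_not_nonempty {V : Type*} {K : Set V} (h : ¬ K.Nonempty) : eulerChar K = 0 :=
  if_neg h

theorem IsValuative.indicatorFun_inter_apply {ι V : Type*} (P : ι → Set V) (S : Set V) (x : V) :
    IsValuative P fun i => indicatorFun (P i ∩ S) x := by
  classical
  by_cases hx : x ∈ S
  · convert IsValuative.indicatorFun_apply P x using 2 with i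
    simp only [indicatorFun, indicator_apply, mem_inter_iff, hx, and_true]
  · convert IsValuative.zero P using 2 with i
    exact indicator_of_notMem (fun h => hx h.2) _

section Slices

variable {ι V : Type*} [NormedAddCommGroup V] [NormedSpace ℝ V] {P : ι → Set V}

theorem subsingleton_image_toExposed (l : StrongDual ℝ V) (K : Set V) :
    (l '' l.toExposed K).Subsingleton := by
  rintro _ ⟨x, hx, rfl⟩ _ ⟨y, hy, rfl⟩
  exact le_antisymm (hy.2 x hx.1) (hx.2 y hy.1)

theorem support_eulerChar_slice_subset (l : StrongDual ℝ V) (K : Set V) :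
    (Function.support fun t => eulerChar (K ∩ l ⁻¹' {t})) ⊆ l '' K := fun t ht => by
  obtain ⟨x, hxK, hx⟩ := of_not_not fun h => ht (eulerChar_of_not_nonempty h)
  exact ⟨x, hxK, hx⟩

theorem eulerChar_eq_finsum_toExposed {K : Set V} (hK : IsCompact K) (l : StrongDual ℝ V) :
    eulerChar K = ∑ᶠ t, eulerChar (l.toExposed K ∩ l ⁻¹' {t}) := by
  by_cases hne : K.Nonempty
  · obtain ⟨x, hxK, hx⟩ := hK.exists_isMaxOn hne l.continuous.continuousOn
    have hxface : x ∈ l.toExposed K := ⟨hxK, hx⟩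
    have hslice : (l.toExposed K ∩ l ⁻¹' {l x}).Nonempty := ⟨x, hxface, rfl⟩
    rw [finsum_eq_single _ (l x) fun t ht => of_not_not fun h => ht <|
      subsingleton_image_toExposed l K (support_eulerChar_slice_subset l _ h) ⟨x, hxface, rfl⟩]
    exact eulerChar_congr ⟨fun _ => hslice, fun _ => hne⟩
  · have hempty : ∀ t, ¬ (l.toExposed K ∩ l ⁻¹' {t}).Nonempty := fun t ⟨x, hx, _⟩ =>
      hne ⟨x, hx.1⟩
    simp only [eulerChar_of_not_nonempty hne, eulerChar_of_not_nonempty (hempty _), finsum_zero]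

/-- The level of the slice is quadratic in the radius of the ball, so that a segment of `K` which
leaves `x` in a direction increasing `l` reaches the slice inside the ball. -/
theorem eventually_nonempty_slice {K : Set V} (hK : Convex ℝ K) {l : StrongDual ℝ V} {x y : V}
    (hx : x ∈ K) (hy : y ∈ K) (hxy : l x < l y) :
    ∀ᶠ δ in 𝓝[>] (0 : ℝ), (K ∩ closedBall x δ ∩ l ⁻¹' {l x + δ ^ 2}).Nonempty := by
  set c := l y - l x
  have hc : 0 < c := sub_pos.2 hxy
  have hsq : ∀ᶠ δ in 𝓝[>] (0 : ℝ), δ ^ 2 < c :=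
    nhdsWithin_le_nhds <| (continuous_pow 2).tendsto' 0 0 (by simp) |>.eventually_lt_const hc
  have hnorm : ∀ᶠ δ in 𝓝[>] (0 : ℝ), δ * ‖y - x‖ < c :=
    nhdsWithin_le_nhds <|
      (continuous_mul_const ‖y - x‖).tendsto' 0 0 (by simp) |>.eventually_lt_const hc
  filter_upwards [self_mem_nhdsWithin, hsq, hnorm] with δ hδ hδc hδy
  have hδ : 0 < δ := hδ
  refine ⟨x + (δ ^ 2 / c) • (y - x), ⟨?_, ?_⟩, ?_⟩
  · exact hK.add_smul_sub_mem hx hy ⟨by positivity, (div_le_one hc).2 hδc.le⟩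
  · rw [mem_closedBall, dist_self_add_left, norm_smul, Real.norm_of_nonneg (by positivity),
      div_mul_eq_mul_div, div_le_iff₀ hc, sq, mul_assoc]
    exact mul_le_mul_of_nonneg_left hδy.le hδ.le
  · rw [mem_preimage, mem_singleton_iff, map_add, map_smul, map_sub, smul_eq_mul,
      div_mul_cancel₀ _ hc.ne']

theorem eventually_eulerChar_slice_eq {K : Set V} (hK : IsClosed K) (hKc : Convex ℝ K)
    (l : StrongDual ℝ V) (x : V) :
    ∀ᶠ δ in 𝓝[>] (0 : ℝ), eulerChar (K ∩ closedBall x δ ∩ l ⁻¹' {l x + δ ^ 2}) =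
      indicatorFun K x - indicatorFun (l.toExposed K) x := by
  by_cases hxK : x ∈ K
  swap
  · obtain ⟨ε, hε, hball⟩ := Metric.isOpen_iff.1 hK.isOpen_compl x hxK
    filter_upwards [Ioo_mem_nhdsGT hε] with δ hδ
    rw [indicatorFun, indicatorFun, indicator_of_notMem hxK,
      indicator_of_notMem (s := l.toExposed K) fun h => hxK h.1, sub_zero]
    refine eulerChar_of_not_nonempty ?_
    rintro ⟨y, ⟨hyK, hy⟩, -⟩
    exact hball (closedBall_subset_ball hδ.2 hy) hyK
  have hxind : indicatorFun K x = 1 := indicator_of_mem hxK _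
  by_cases hmax : ∀ y ∈ K, l y ≤ l x
  · have hface : indicatorFun (l.toExposed K) x = 1 :=
      indicator_of_mem (s := l.toExposed K) ⟨hxK, hmax⟩ _
    filter_upwards [self_mem_nhdsWithin] with δ hδ
    rw [hxind, hface, sub_self]
    refine eulerChar_of_not_nonempty ?_
    rintro ⟨y, ⟨hyK, -⟩, hy⟩
    linarith [hmax y hyK, pow_pos (mem_Ioi.1 hδ) 2, show l y = l x + δ ^ 2 from hy]
  · have hface : indicatorFun (l.toExposed K) x = 0 := indicator_of_notMem (fun h => hmax h.2) _
    push Not at hmax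
    obtain ⟨y, hyK, hxy⟩ := hmax
    filter_upwards [eventually_nonempty_slice hKc hxK hyK hxy] with δ hδ
    rw [hxind, hface, sub_zero, eulerChar_of_nonempty hδ]

/-- Moving the slice into `K` in the direction of `l` detects the points of `K` outside the face. -/
theorem isValuative_indicatorFun_toExposed_of_slice [ProperSpace V] {l : StrongDual ℝ V}
    (hslice : ∀ Q : ι → Set V, (∀ i, IsCompact (Q i)) → (∀ i, Convex ℝ (Q i)) →
      ∀ t, IsValuative Q fun i => eulerChar (Q i ∩ l ⁻¹' {t}))
    (hP : ∀ i, IsClosed (P i)) (hPc : ∀ i, Convex ℝ (P i)) (x : V) :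
    IsValuative P fun i => indicatorFun (l.toExposed (P i)) x := by
  have hlocal : IsValuative P fun i => indicatorFun (P i) x - indicatorFun (l.toExposed (P i)) x :=
    IsValuative.of_eventually (l := 𝓝[>] (0 : ℝ))
      (f := fun δ i => eulerChar (P i ∩ closedBall x δ ∩ l ⁻¹' {l x + δ ^ 2}))
      (fun δ => (hslice _ (fun i => (isCompact_closedBall x δ).inter_left (hP i))
        (fun i => (hPc i).inter (convex_closedBall x δ)) _).trans
          (IsValuative.indicatorFun_inter_apply P _))
      fun i => eventually_eulerChar_slice_eq (hP i) (hPc i) l x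
  simpa only [sub_sub_cancel] using (IsValuative.indicatorFun_apply P x).sub hlocal

theorem isValuative_eulerChar_slice {l : StrongDual ℝ V} (hl : l ≠ 0)
    (hker : ∀ Q : ι → Set l.ker, (∀ i, IsCompact (Q i)) → (∀ i, Convex ℝ (Q i)) →
      IsValuative Q fun i => eulerChar (Q i))
    (hP : ∀ i, IsCompact (P i)) (hPc : ∀ i, Convex ℝ (P i)) (t : ℝ) :
    IsValuative P fun i => eulerChar (P i ∩ l ⁻¹' {t}) := by
  obtain ⟨v, hv⟩ : ∃ v, l v = t := l.toLinearMap.surjective (by exact_mod_cast hl) t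
  have hemb : IsClosedEmbedding fun y : l.ker => v + y :=
    (Homeomorph.addLeft v).isClosedEmbedding.comp l.isClosed_ker.isClosedEmbedding_subtypeVal
  have hval := hker (fun i => (fun y : l.ker => v + y) ⁻¹' P i)
    (fun i => hemb.isCompact_preimage (hP i))
    (fun i => ((hPc i).translate_preimage_right v).linear_preimage l.ker.subtype)
  have hne : ∀ i, ((fun y : l.ker => v + y) ⁻¹' P i).Nonempty ↔ (P i ∩ l ⁻¹' {t}).Nonempty := by
    refine fun i => ⟨?_, ?_⟩
    · rintro ⟨y, hy⟩
      exact ⟨v + y, hy, by simp [hv]⟩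
    · rintro ⟨x, hxP, hx⟩
      refine ⟨⟨x - v, ?_⟩, by simpa using hxP⟩
      rw [LinearMap.mem_ker, map_sub, sub_eq_zero]
      exact (mem_singleton_iff.1 hx).trans hv.symm
  simp only [← eulerChar_congr (hne _)]
  exact hval.trans fun y => IsValuative.indicatorFun_apply P (v + y)

end Slices

variable {ι V : Type*} [NormedAddCommGroup V] [NormedSpace ℝ V] [FiniteDimensional ℝ V]
  {P : ι → Set V}

/-- By induction on the dimension, as a nonempty compact convex set has exactly one nonempty slice
among those of its face in a given direction. -/
theorem isValuative_eulerChar (hP : ∀ i, IsCompact (P i)) (hPc : ∀ i, Convex ℝ (P i)) :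
    IsValuative P fun i => eulerChar (P i) := by
  induction hn : Module.finrank ℝ V generalizing V with
  | zero =>
    have := Module.finrank_zero_iff.1 hn
    have hpoint : ∀ i, (P i).Nonempty ↔ 0 ∈ P i := fun i =>
      ⟨fun ⟨x, hx⟩ => Subsingleton.elim x 0 ▸ hx, fun h => ⟨0, h⟩⟩
    simpa only [indicatorFun_eq_eulerChar (hpoint _)] using IsValuative.indicatorFun_apply P 0
  | succ n ih =>
    have : Nontrivial V := Module.nontrivial_of_finrank_eq_succ hn
    have : ProperSpace V := FiniteDimensional.proper_real V
    obtain ⟨l, hl⟩ := exists_ne (0 : StrongDual ℝ V)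
    have hrank : Module.finrank ℝ l.ker = n := by
      have := Module.Dual.finrank_ker_add_one_of_ne_zero (f := l.toLinearMap) (by exact_mod_cast hl)
      lia
    have hslice : ∀ Q : ι → Set V, (∀ i, IsCompact (Q i)) → (∀ i, Convex ℝ (Q i)) →
        ∀ t, IsValuative Q fun i => eulerChar (Q i ∩ l ⁻¹' {t}) := fun Q hQ hQc =>
      isValuative_eulerChar_slice hl (fun R hR hRc => ih hR hRc hrank) hQ hQc
    have hface : ∀ x, IsValuative P fun i => indicatorFun (l.toExposed (P i)) x :=
      isValuative_indicatorFun_toExposed_of_slice hslice (fun i => (hP i).isClosed) hPc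
    have hexp : ∀ i, IsExposed ℝ (P i) (l.toExposed (P i)) := fun i =>
      ContinuousLinearMap.toExposed.isExposed
    simp only [eulerChar_eq_finsum_toExposed (hP _) l]
    refine IsValuative.finsum (fun t => (hslice _ (fun i => (hexp i).isCompact (hP i))
      (fun i => (hexp i).convex (hPc i)) t).trans hface) fun i => ?_
    exact (subsingleton_image_toExposed l (P i)).finite.subset
      (support_eulerChar_slice_subset l _)

theorem isValuative_indicatorFun_toExposed (hP : ∀ i, IsCompact (P i))
    (hPc : ∀ i, Convex ℝ (P i)) (l : StrongDual ℝ V) (x : V) :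
    IsValuative P fun i => indicatorFun (l.toExposed (P i)) x := by
  have : ProperSpace V := FiniteDimensional.proper_real V
  refine isValuative_indicatorFun_toExposed_of_slice (fun Q hQ hQc t => ?_)
    (fun i => (hP i).isClosed) hPc x
  have hclosed : IsClosed (l ⁻¹' {t}) := isClosed_singleton.preimage l.continuous
  have hconv : Convex ℝ (l ⁻¹' {t}) := (convex_singleton t).linear_preimage l.toLinearMap
  exact (isValuative_eulerChar (fun i => (hQ i).inter_right hclosed)
    fun i => (hQc i).inter hconv).trans (IsValuative.indicatorFun_inter_apply Q _)

theorem isValuative_eulerChar_inter_pos {J : Type*} [Finite J] {P : ι → Set (J → ℝ)}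
    (hP : ∀ i, IsCompact (P i)) (hPc : ∀ i, Convex ℝ (P i)) :
    IsValuative P fun i => eulerChar (P i ∩ {y | ∀ e, 0 < y e}) := by
  have := Fintype.ofFinite J
  have hclosed : ∀ ε : ℝ, IsClosed {y : J → ℝ | ∀ e, ε ≤ y e} := fun ε =>
    isClosed_Ici (a := fun _ => ε)
  have hconv : ∀ ε : ℝ, Convex ℝ {y : J → ℝ | ∀ e, ε ≤ y e} := fun ε =>
    convex_Ici (𝕜 := ℝ) fun _ => ε
  refine IsValuative.of_eventually (l := 𝓝[>] (0 : ℝ))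
    (f := fun ε i => eulerChar (P i ∩ {y | ∀ e, ε ≤ y e}))
    (fun ε => (isValuative_eulerChar (fun i => (hP i).inter_right (hclosed ε))
      fun i => (hPc i).inter (hconv ε)).trans (IsValuative.indicatorFun_inter_apply P _))
    fun i => ?_
  have hmono : ∀ ε : ℝ, 0 < ε → (P i ∩ {y | ∀ e, ε ≤ y e}).Nonempty →
      (P i ∩ {y | ∀ e, 0 < y e}).Nonempty := fun ε hε ⟨y, hyP, hy⟩ =>
    ⟨y, hyP, fun e => hε.trans_le (hy e)⟩
  by_cases hne : (P i ∩ {y | ∀ e, 0 < y e}).Nonempty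
  · obtain ⟨y, hyP, hy⟩ := id hne
    have hsmall : ∀ᶠ ε in 𝓝[>] (0 : ℝ), ∀ e, ε < y e :=
      eventually_all.2 fun e => nhdsWithin_le_nhds (eventually_lt_nhds (hy e))
    filter_upwards [self_mem_nhdsWithin, hsmall] with ε hε hεy
    exact eulerChar_congr ⟨hmono ε hε, fun _ => ⟨y, hyP, fun e => (hεy e).le⟩⟩
  · filter_upwards [self_mem_nhdsWithin] with ε hε
    exact eulerChar_congr ⟨hmono ε hε, fun h => absurd h hne⟩

end EulerCharacteristic

section AdaptedBase

variable {α : Type*} {M : Matroid α} {C : Finset (Set α)} {B : Set α}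

/-- A base of `M` which is adapted to a family `C` of sets: it restricts to a basis of each of them.
For a chain `C` of flats these bases are the vertices of a face of the base polytope. -/
def IsAdaptedBase (M : Matroid α) (C : Finset (Set α)) (B : Set α) : Prop :=
  M.IsBase B ∧ ∀ F ∈ C, M.IsBasis (B ∩ F) F

theorem isFlat_empty (hl : M.Loopless) : M.IsFlat ∅ := by
  rw [Matroid.isFlat_iff_closure_eq, Matroid.closure_empty, hl.loops_eq_empty]

theorem exists_isAdaptedBase (hC : IsChain (· ⊆ ·) (C : Set (Set α))) (hCE : ∀ F ∈ C, F ⊆ M.E) :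
    ∃ B, IsAdaptedBase M C B := by
  classical
  induction C using Finset.strongInduction with
  | H C ih =>
  rcases C.eq_empty_or_nonempty with rfl | hne
  · obtain ⟨B, hB⟩ := M.exists_isBase
    exact ⟨B, hB, by simp⟩
  obtain ⟨F, hF, hmax⟩ := C.exists_maximal hne
  obtain ⟨B, hB, hBC⟩ := ih _ (Finset.erase_ssubset hF)
    (hC.mono (Finset.coe_subset.2 (Finset.erase_subset _ _)))
    fun G hG => hCE G (Finset.mem_of_mem_erase hG)
  obtain ⟨J, hJ, hBJ⟩ :=
    (hB.indep.subset inter_subset_left).subset_isBasis_of_subset inter_subset_right (hCE F hF)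
  obtain ⟨B', hB', hJB'⟩ := hJ.indep.exists_isBase_superset
  refine ⟨B', hB', fun G hG => ?_⟩
  by_cases hGF : G = F
  · rwa [hGF, hJ.inter_eq_of_subset_indep hJB' hB'.indep]
  · have hle : G ⊆ F := (hC.total hG hF).elim id (hmax hG)
    have hBG := hBC G (Finset.mem_erase.2 ⟨hGF, hG⟩)
    have hsub : B ∩ G ⊆ B' :=
      (inter_subset_inter_right B hle).trans (hBJ.trans hJB')
    rwa [hBG.inter_eq_of_subset_indep hsub hB'.indep]

theorem IsAdaptedBase.mem_of_mem_closure (hB : IsAdaptedBase M C B) {F : Set α} (hF : F ∈ C)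
    {e : α} (heB : e ∈ B) (he : e ∈ M.closure F) : e ∈ F := by
  rw [← (hB.2 F hF).closure_eq_closure] at he
  exact ((hB.1.indep.closure_inter_eq_self_of_subset inter_subset_left).subset ⟨he, heB⟩).2

/-- If `G` is the largest member of the chain avoiding `e`, then adding `G ∪ {e}` to the chain
forces an adapted base to contain `e`. -/
theorem exists_isAdaptedBase_mem (hl : M.Loopless) (hC : IsChain (· ⊆ ·) (C : Set (Set α)))
    (hflat : ∀ F ∈ C, M.IsFlat F) {e : α} (he : e ∈ M.E) : ∃ B, IsAdaptedBase M C B ∧ e ∈ B := by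
  classical
  have hflat' : ∀ F ∈ insert ∅ C, M.IsFlat F :=
    Finset.forall_mem_insert _ _ _ |>.2 ⟨isFlat_empty hl, hflat⟩
  have hC' : IsChain (· ⊆ ·) ((insert ∅ C : Finset (Set α)) : Set (Set α)) := by
    rw [Finset.coe_insert]
    exact hC.insert fun F _ _ => Or.inl (empty_subset F)
  obtain ⟨G, hG, hmax⟩ := ((insert ∅ C).filter (e ∉ ·)).exists_maximal
    ⟨∅, Finset.mem_filter.2 ⟨Finset.mem_insert_self _ _, notMem_empty e⟩⟩
  rw [Finset.mem_filter] at hG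
  have hchain : IsChain (· ⊆ ·) ((insert (insert e G) C : Finset (Set α)) : Set (Set α)) := by
    rw [Finset.coe_insert]
    refine hC.insert fun F hF _ => ?_
    have hF' : F ∈ insert ∅ C := Finset.mem_insert_of_mem hF
    have htotal := hC'.total hF' hG.1
    by_cases heF : e ∈ F
    · exact Or.inl (insert_subset heF (htotal.resolve_left fun h => hG.2 (h heF)))
    · have hFG : F ⊆ G := htotal.elim id (hmax (Finset.mem_filter.2 ⟨hF', heF⟩))
      exact Or.inr (hFG.trans (subset_insert e G))
  obtain ⟨B, hB, hBC⟩ := exists_isAdaptedBase (M := M) hchain <|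
    Finset.forall_mem_insert _ _ _ |>.2
      ⟨insert_subset he (hflat' G hG.1).subset_ground, fun F hF => (hflat F hF).subset_ground⟩
  refine ⟨B, ⟨hB, fun F hF => hBC F (Finset.mem_insert_of_mem hF)⟩, by_contra fun heB => hG.2 ?_⟩
  rw [← (hflat' G hG.1).closure]
  refine M.closure_subset_closure ?_ <|
    (hBC _ (Finset.mem_insert_self _ _)).subset_closure (mem_insert e G)
  rintro x ⟨hxB, rfl | hxG⟩
  exacts [absurd hxB heB, hxG]

theorem forall_exists_isAdaptedBase_mem_iff (hC : IsChain (· ⊆ ·) (C : Set (Set α)))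
    (hCE : ∀ F ∈ C, F ⊆ M.E) :
    (∀ e ∈ M.E, ∃ B, IsAdaptedBase M C B ∧ e ∈ B) ↔ M.Loopless ∧ ∀ F ∈ C, M.IsFlat F := by
  refine ⟨fun h => ⟨?_, fun F hF => ?_⟩, fun h e he => exists_isAdaptedBase_mem h.1 hC h.2 he⟩
  · refine Matroid.loopless_iff_forall_isNonloop.2 fun e he => ?_
    obtain ⟨B, hB, heB⟩ := h e he
    exact hB.1.indep.isNonloop_of_mem heB
  · rw [Matroid.isFlat_iff_closure_eq]
    refine Subset.antisymm (fun e he => ?_) (M.subset_closure F (hCE F hF))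
    obtain ⟨B, hB, heB⟩ := h e (M.closure_subset_ground F he)
    exact hB.mem_of_mem_closure hF heB he

end AdaptedBase

section BasePolytope

theorem mem_toExposed_sum_iff {κ V : Type*} [AddCommGroup V] [TopologicalSpace V] [Module ℝ V]
    {s : Finset κ} {l : κ → StrongDual ℝ V} {A : Set V} {x y : V}
    (hx : ∀ k ∈ s, x ∈ (l k).toExposed A) (hxA : x ∈ A) (hy : y ∈ A) :
    y ∈ (∑ k ∈ s, l k).toExposed A ↔ ∀ k ∈ s, y ∈ (l k).toExposed A := by
  have hle : ∀ z ∈ A, ∀ k ∈ s, l k z ≤ l k x := fun z hz k hk => (hx k hk).2 z hz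
  simp only [ContinuousLinearMap.toExposed, mem_ofPred_eq, hy, true_and,
    sum_apply]
  refine ⟨fun h k hk z hz => ?_, fun h z hz => Finset.sum_le_sum fun k hk => h k hk z hz⟩
  have heq := (Finset.sum_eq_sum_iff_of_le (hle y hy)).1
    (le_antisymm (Finset.sum_le_sum (hle y hy)) (h x hxA))
  exact (hle z hz k hk).trans (heq k hk).ge

variable {α : Type*} {E : Finset α} {M : Matroid α} {C : Finset (Set α)} {B F : Set α}

/-- The indicator vector in `ℝ ^ E` of a set. -/
noncomputable def indicatorVector (E : Finset α) (B : Set α) : E → ℝ :=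
  fun e => B.indicator (fun _ => 1) (e : α)

/-- The linear form on `ℝ ^ E` summing the coordinates in a set. -/
noncomputable def coordSum (E : Finset α) (F : Set α) : StrongDual ℝ (E → ℝ) :=
  ∑ e : E, indicatorVector E F e • ContinuousLinearMap.proj e

theorem indicatorVector_of_mem {e : E} (he : (e : α) ∈ B) : indicatorVector E B e = 1 :=
  indicator_of_mem he _

theorem indicatorVector_of_notMem {e : E} (he : (e : α) ∉ B) : indicatorVector E B e = 0 :=
  indicator_of_notMem he _

theorem basePolytope_eq :
    basePolytope E M = convexHull ℝ (indicatorVector E '' {B | M.IsBase B}) := by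
  rw [basePolytope]
  congr 1
  ext x
  exact exists_congr fun B => and_congr_right fun _ => eq_comm

theorem indicatorVector_mem_basePolytope (hB : M.IsBase B) :
    indicatorVector E B ∈ basePolytope E M :=
  basePolytope_eq (E := E) ▸ subset_convexHull ℝ _ (mem_image_of_mem _ hB)

theorem convex_basePolytope : Convex ℝ (basePolytope E M) :=
  convex_convexHull ℝ _

theorem isCompact_basePolytope (hM : M.E = E) : IsCompact (basePolytope E M) := by
  rw [basePolytope_eq]
  refine Finite.isCompact_convexHull ℝ (Finite.image _ (E.finite_toSet.finite_subsets.subset ?_))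
  exact fun B hB => hM ▸ hB.subset_ground

theorem coordSum_indicatorVector (hB : B ⊆ E) :
    coordSum E F (indicatorVector E B) = (B ∩ F).ncard := by
  classical
  have hBF : ((E.filter (· ∈ B ∩ F) : Finset α) : Set α) = B ∩ F := by
    rw [Finset.coe_filter]
    exact sep_eq_of_subset (inter_subset_left.trans hB)
  calc coordSum E F (indicatorVector E B)
      = ∑ e : E, if (e : α) ∈ B ∩ F then (1 : ℝ) else 0 := by
        simp only [coordSum, sum_apply, smul_apply, ContinuousLinearMap.proj_apply, smul_eq_mul,
          indicatorVector, indicator_apply, mem_inter_iff, ite_zero_mul_ite_zero, mul_one,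
          and_comm]
    _ = ∑ e ∈ E, if e ∈ B ∩ F then 1 else 0 :=
        Finset.sum_coe_sort E fun e => if e ∈ B ∩ F then (1 : ℝ) else 0
    _ = (B ∩ F).ncard := by rw [Finset.sum_boole, ← ncard_coe_finset, hBF]

theorem coordSum_le_of_mem_basePolytope (hM : M.E = E) {c : ℝ}
    (hc : ∀ B, M.IsBase B → ((B ∩ F).ncard : ℝ) ≤ c) {x : E → ℝ} (hx : x ∈ basePolytope E M) :
    coordSum E F x ≤ c := by
  rw [basePolytope_eq] at hx
  refine convexHull_min ?_ (convex_halfSpace_le (coordSum E F).isLinear c) hx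
  rintro _ ⟨B, hB, rfl⟩
  change coordSum E F (indicatorVector E B) ≤ c
  rw [coordSum_indicatorVector (hM ▸ hB.subset_ground)]
  exact hc B hB

/-- The maximum of `coordSum E F` on the base polytope is the rank of `F`. -/
theorem indicatorVector_mem_toExposed_coordSum_iff (hM : M.E = E) (hB : M.IsBase B)
    (hF : F ⊆ M.E) :
    indicatorVector E B ∈ (coordSum E F).toExposed (basePolytope E M) ↔ M.IsBasis (B ∩ F) F := by
  have hfin : F.Finite := E.finite_toSet.subset (hM ▸ hF)
  have hsum : ∀ {B}, M.IsBase B → coordSum E F (indicatorVector E B) = (B ∩ F).ncard :=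
    fun hB => coordSum_indicatorVector (hM ▸ hB.subset_ground)
  constructor
  · rintro ⟨-, hmax⟩
    obtain ⟨J, hJ, hBJ⟩ :=
      (hB.indep.subset inter_subset_left).subset_isBasis_of_subset inter_subset_right hF
    obtain ⟨B', hB', hJB'⟩ := hJ.indep.exists_isBase_superset
    have hle := hmax _ (indicatorVector_mem_basePolytope hB')
    rw [hsum hB, hsum hB', hJ.inter_eq_of_subset_indep hJB' hB'.indep, Nat.cast_le] at hle
    rwa [eq_of_subset_of_ncard_le hBJ hle (hfin.subset hJ.subset)]
  · refine fun hBF => ⟨indicatorVector_mem_basePolytope hB, fun x hx => ?_⟩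
    rw [hsum hB]
    refine coordSum_le_of_mem_basePolytope hM (fun B' hB' => ?_) hx
    have hle := (hB'.indep.subset inter_subset_left).encard_le_eRk_of_subset
      (inter_subset_right (s := B') (t := F))
    rw [← hBF.encard_eq_eRk] at hle
    exact_mod_cast ENat.toNat_le_toNat hle (hfin.inter_of_right B).encard_lt_top.ne

/-- The face of the base polytope cut out by a chain of subsets of the ground set. -/
noncomputable def chainFace (E : Finset α) (C : Finset (Set α)) (M : Matroid α) : Set (E → ℝ) :=
  (∑ F ∈ C, coordSum E F).toExposed (basePolytope E M)

theorem isExposed_chainFace : IsExposed ℝ (basePolytope E M) (chainFace E C M) :=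
  ContinuousLinearMap.toExposed.isExposed

theorem isCompact_chainFace (hM : M.E = E) : IsCompact (chainFace E C M) :=
  isExposed_chainFace.isCompact (isCompact_basePolytope hM)

theorem convex_chainFace : Convex ℝ (chainFace E C M) :=
  isExposed_chainFace.convex convex_basePolytope

theorem indicatorVector_mem_chainFace_iff (hM : M.E = E)
    (hC : IsChain (· ⊆ ·) (C : Set (Set α))) (hCE : ∀ F ∈ C, F ⊆ M.E) (hB : M.IsBase B) :
    indicatorVector E B ∈ chainFace E C M ↔ IsAdaptedBase M C B := by
  obtain ⟨A, hA, hAC⟩ := exists_isAdaptedBase hC hCE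
  rw [chainFace, mem_toExposed_sum_iff (x := indicatorVector E A)
    (fun F hF => (indicatorVector_mem_toExposed_coordSum_iff hM hA (hCE F hF)).2 (hAC F hF))
    (indicatorVector_mem_basePolytope hA) (indicatorVector_mem_basePolytope hB)]
  simp only [IsAdaptedBase, hB, true_and]
  exact forall₂_congr fun F hF => indicatorVector_mem_toExposed_coordSum_iff hM hB (hCE F hF)

/-- By the Krein–Milman theorem a face lies in the closed convex hull of its vertices. -/
theorem exists_indicatorVector_mem_chainFace (hM : M.E = E) {x : E → ℝ}
    (hx : x ∈ chainFace E C M) {e : E} (hxe : 0 < x e) :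
    ∃ B, M.IsBase B ∧ indicatorVector E B ∈ chainFace E C M ∧ (e : α) ∈ B := by
  by_contra! hB
  have hzero : IsClosed {y : E → ℝ | y e ≤ 0} := isClosed_le (continuous_apply e) continuous_const
  rw [← closure_convexHull_extremePoints (isCompact_chainFace hM) convex_chainFace] at hx
  refine hxe.not_ge <| closure_minimal (convexHull_min (fun y hy => ?_) ?_) hzero hx
  · have hyP := isExposed_chainFace.isExtreme.extremePoints_subset_extremePoints hy
    rw [basePolytope_eq] at hyP
    obtain ⟨B, hBM, rfl⟩ := extremePoints_convexHull_subset hyP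
    exact (indicatorVector_of_notMem (hB B hBM hy.1)).le
  · exact convex_halfSpace_le (LinearMap.proj e : (E → ℝ) →ₗ[ℝ] ℝ).isLinear 0

theorem chainFace_inter_pos_nonempty_iff (hM : M.E = E)
    (hC : IsChain (· ⊆ ·) (C : Set (Set α))) (hCE : ∀ F ∈ C, F ⊆ M.E) :
    (chainFace E C M ∩ {x | ∀ e, 0 < x e}).Nonempty ↔ M.Loopless ∧ ∀ F ∈ C, M.IsFlat F := by
  classical
  rw [← forall_exists_isAdaptedBase_mem_iff hC hCE]
  constructor
  · rintro ⟨x, hxC, hx⟩ e he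
    obtain ⟨B, hB, hBC, heB⟩ := exists_indicatorVector_mem_chainFace hM hxC
      (hx ⟨e, by rwa [hM] at he⟩)
    exact ⟨B, (indicatorVector_mem_chainFace_iff hM hC hCE hB).1 hBC, heB⟩
  · intro h
    have hfin : {B | IsAdaptedBase M C B}.Finite :=
      E.finite_toSet.finite_subsets.subset fun B hB => hM ▸ hB.1.subset_ground
    set 𝓑 := hfin.toFinset
    have hmem : ∀ {B}, B ∈ 𝓑 ↔ IsAdaptedBase M C B := hfin.mem_toFinset
    obtain ⟨B₀, hB₀⟩ := exists_isAdaptedBase hC hCE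
    have hcard : 0 < (𝓑.card : ℝ) := Nat.cast_pos.2 (Finset.card_pos.2 ⟨B₀, hmem.2 hB₀⟩)
    refine ⟨∑ B ∈ 𝓑, (𝓑.card : ℝ)⁻¹ • indicatorVector E B, ?_, fun e => ?_⟩
    · refine convex_chainFace.sum_mem (fun _ _ => by positivity) ?_ fun B hB => ?_
      · rw [Finset.sum_const, nsmul_eq_mul, mul_inv_cancel₀ hcard.ne']
      · exact (indicatorVector_mem_chainFace_iff hM hC hCE (hmem.1 hB).1).2 (hmem.1 hB)
    · obtain ⟨B, hB, heB⟩ := h e (hM ▸ e.2)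
      rw [Finset.sum_apply]
      refine Finset.sum_pos' (fun A _ => ?_) ⟨B, hmem.2 hB, ?_⟩
      · exact mul_nonneg (by positivity) (indicator_nonneg (fun _ _ => zero_le_one) _)
      · rw [Pi.smul_apply, indicatorVector_of_mem heB]
        positivity

theorem coordSum_univ_of_mem_basePolytope (hM : M.E = E) {x : E → ℝ}
    (hx : x ∈ basePolytope E M) : coordSum E univ x = M.eRank.toNat := by
  rw [basePolytope_eq] at hx
  refine convexHull_min ?_ (convex_hyperplane (coordSum E univ).isLinear _) hx
  rintro _ ⟨B, hB, rfl⟩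
  change coordSum E univ (indicatorVector E B) = M.eRank.toNat
  rw [coordSum_indicatorVector (hM ▸ hB.subset_ground), inter_univ, ncard_def, hB.encard_eq_eRank]

theorem toNat_eRank_eq_of_basePolytope_inter {N : Matroid α} (hM : M.E = E) (hN : N.E = E)
    (h : (basePolytope E M ∩ basePolytope E N).Nonempty) : M.eRank.toNat = N.eRank.toNat := by
  obtain ⟨x, hxM, hxN⟩ := h
  exact_mod_cast (coordSum_univ_of_mem_basePolytope hM hxM).symm.trans
    (coordSum_univ_of_mem_basePolytope hN hxN)

theorem isValuative_eulerChar_chainFace_inter_pos {ι : Type*} {M : ι → Matroid α}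
    (hM : ∀ i, (M i).E = E) (C : Finset (Set α)) :
    IsValuative (fun i => basePolytope E (M i)) fun i =>
      eulerChar (chainFace E C (M i) ∩ {x | ∀ e, 0 < x e}) :=
  (isValuative_eulerChar_inter_pos (fun i => isCompact_chainFace (hM i))
    fun _ => convex_chainFace).trans <|
      isValuative_indicatorFun_toExposed (fun i => isCompact_basePolytope (hM i))
        (fun _ => convex_basePolytope) _

end BasePolytope

section FPolynomial

variable {V W : Type*}

theorem fPolynomial_image_map (Δ : Set (Finset V)) (e : V ↪ W) :
    fPolynomial (Finset.map e '' Δ) = fPolynomial Δ := by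
  have hmax : maxFaceSize (Finset.map e '' Δ) = maxFaceSize Δ := by
    simp only [maxFaceSize, image_image, Finset.card_map]
  have hvec : ∀ i, fVector (Finset.map e '' Δ) i = fVector Δ i := fun i => by
    have himage : {C | C ∈ Finset.map e '' Δ ∧ C.card = i} =
        Finset.map e '' {C | C ∈ Δ ∧ C.card = i} := by
      ext C
      constructor
      · rintro ⟨⟨D, hD, rfl⟩, hC⟩
        exact ⟨D, ⟨hD, by rwa [Finset.card_map] at hC⟩, rfl⟩
      · rintro ⟨D, ⟨hD, hC⟩, rfl⟩
        exact ⟨⟨D, hD, rfl⟩, by rwa [Finset.card_map]⟩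
    rw [fVector, himage, ncard_image_of_injective _ (Finset.map_injective e), fVector]
  simp only [fPolynomial, hmax, hvec]

theorem card_le_maxFaceSize {Δ : Set (Finset V)} (hΔ : Δ.Finite) {C : Finset V} (hC : C ∈ Δ) :
    C.card ≤ maxFaceSize Δ :=
  le_csSup (hΔ.image _).bddAbove (mem_image_of_mem _ hC)

theorem fPolynomial_eq_finsum {Δ : Set (Finset V)} (hΔ : Δ.Finite) :
    fPolynomial Δ = ∑ᶠ C ∈ Δ, (X : ℤ[X]) ^ (maxFaceSize Δ - C.card) := by
  have hcard : ∀ C ∈ hΔ.toFinset, C.card ∈ Finset.range (maxFaceSize Δ + 1) := fun C hC =>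
    Finset.mem_range_succ_iff.2 (card_le_maxFaceSize hΔ (hΔ.mem_toFinset.1 hC))
  have hvec : ∀ i, fVector Δ i = (hΔ.toFinset.filter (·.card = i)).card := fun i => by
    rw [← ncard_coe_finset, fVector, Finset.coe_filter]
    simp only [hΔ.mem_toFinset]
  rw [finsum_mem_eq_finite_toFinset_sum _ hΔ, ← Finset.sum_fiberwise_of_maps_to hcard, fPolynomial]
  refine Finset.sum_congr rfl fun i _ => ?_
  rw [Finset.sum_congr rfl fun D hD => by rw [(Finset.mem_filter.1 hD).2], Finset.sum_const, hvec,
    nsmul_eq_mul]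
  simp only [map_natCast]

end FPolynomial

section ChainsOfFlats

variable {α : Type*} {M : Matroid α} {C : Finset (Set α)}

/-- The order complex of the proper part of the lattice of flats of a loopless matroid, with its
vertices regarded as sets so that it does not live on a type depending on the matroid. -/
def flatChains (M : Matroid α) : Set (Finset (Set α)) :=
  {C | IsChain (· ⊆ ·) (C : Set (Set α)) ∧ ∀ F ∈ C, M.IsFlat F ∧ F ≠ ∅ ∧ F ≠ M.E}

theorem isBot_flats_iff (hl : M.Loopless) (F : Flats M) : IsBot F ↔ F.1 = ∅ :=
  ⟨fun h => subset_empty_iff.1 (h ⟨∅, isFlat_empty hl⟩),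
    fun h G => h.subset.trans (empty_subset G.1)⟩

theorem isTop_flats_iff (F : Flats M) : IsTop F ↔ F.1 = M.E :=
  ⟨fun h => F.2.subset_ground.antisymm (h ⟨M.E, M.ground_isFlat⟩),
    fun h G => G.2.subset_ground.trans h.superset⟩

theorem image_map_orderComplex_flats (hl : M.Loopless) :
    Finset.map (Function.Embedding.subtype M.IsFlat) '' orderComplex (Flats M) = flatChains M := by
  classical
  ext C
  constructor
  · rintro ⟨D, ⟨hD, hDF⟩, rfl⟩
    refine ⟨?_, ?_⟩
    · rw [Finset.coe_map]
      rintro _ ⟨F, hF, rfl⟩ _ ⟨G, hG, rfl⟩ -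
      exact hD.total hF hG
    · rintro _ hF
      obtain ⟨F, hFD, rfl⟩ := Finset.mem_map.1 hF
      exact ⟨F.2, fun h => (hDF F hFD).1 ((isBot_flats_iff hl F).2 h),
        fun h => (hDF F hFD).2 ((isTop_flats_iff F).2 h)⟩
  · rintro ⟨hC, hCF⟩
    refine ⟨C.subtype M.IsFlat, ⟨?_, fun F hF => ?_⟩,
      Finset.subtype_map_of_mem fun F hF => (hCF F hF).1⟩
    · exact fun F hF G hG _ => hC.total (Finset.mem_subtype.1 hF) (Finset.mem_subtype.1 hG)
    · have := hCF F.1 (Finset.mem_subtype.1 hF)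
      rw [isBot_flats_iff hl, isTop_flats_iff]
      exact this.2

theorem finite_flatChains [M.Finite] : (flatChains M).Finite :=
  (M.ground_finite.finite_subsets.finite_subsets.preimage Finset.coe_injective.injOn).subset
    fun _ hC F hF => (hC.2 F hF).1.subset_ground

/-- An adapted base meets the flats of the chain in sets of distinct sizes. -/
theorem card_le_of_isChain_isFlat [M.Finite] (hC : IsChain (· ⊆ ·) (C : Set (Set α)))
    (hflat : ∀ F ∈ C, M.IsFlat F) : C.card ≤ M.eRank.toNat + 1 := by
  obtain ⟨B, hB, hBC⟩ := exists_isAdaptedBase hC fun F hF => (hflat F hF).subset_ground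
  have hBfin : B.Finite := M.set_finite B hB.subset_ground
  have hle : ∀ F ∈ C, ∀ G ∈ C, F ⊆ G → (B ∩ F).ncard = (B ∩ G).ncard → F = G :=
    fun F hF G hG hFG h => by
      rw [← (hflat F hF).closure, ← (hflat G hG).closure, ← (hBC F hF).closure_eq_closure,
        ← (hBC G hG).closure_eq_closure, eq_of_subset_of_ncard_le
          (inter_subset_inter_right B hFG) h.ge (hBfin.inter_of_left G)]
  have hinj : InjOn (fun F => (B ∩ F).ncard) C := fun F hF G hG h =>
    (hC.total hF hG).elim (hle F hF G hG · h) fun hGF => (hle G hG F hF hGF h.symm).symm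
  rw [← hB.encard_eq_eRank, ← ncard_def, ← Finset.card_range (B.ncard + 1)]
  refine Finset.card_le_card_of_injOn _ (fun F _ => Finset.mem_coe.2 ?_) hinj
  exact Finset.mem_range_succ_iff.2 (ncard_le_ncard inter_subset_left hBfin)

theorem exists_isChain_isFlat_card_eq (I : Finset α) (hI : M.Indep I) :
    ∃ C : Finset (Set α), IsChain (· ⊆ ·) (C : Set (Set α)) ∧ C.card = I.card + 1 ∧
      ∀ F ∈ C, M.IsFlat F ∧ F ⊆ M.closure I := by
  classical
  induction I using Finset.induction_on with
  | empty => exact ⟨{M.closure ∅}, by simp, by simp, by simp⟩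
  | insert e I he ih =>
    rw [Finset.coe_insert] at hI ⊢
    have hI' := hI.subset (subset_insert e (I : Set α))
    obtain ⟨C, hC, hcard, hCF⟩ := ih hI'
    have hmono : M.closure I ⊆ M.closure (insert e I) :=
      M.closure_subset_closure (subset_insert e (I : Set α))
    have hnew : M.closure (insert e I) ∉ C := fun hmem =>
      ((hI'.insert_indep_iff_of_notMem he).1 hI).2 <| (hCF _ hmem).2 <|
        M.subset_closure _ hI.subset_ground (mem_insert e (I : Set α))
    refine ⟨insert (M.closure (insert e I)) C, ?_, ?_, ?_⟩
    · rw [Finset.coe_insert]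
      exact hC.insert fun F hF _ => Or.inr ((hCF F hF).2.trans hmono)
    · rw [Finset.card_insert_of_notMem hnew, Finset.card_insert_of_notMem he, hcard]
    · exact Finset.forall_mem_insert _ _ _ |>.2
        ⟨⟨M.isFlat_closure _, Subset.rfl⟩, fun F hF => ⟨(hCF F hF).1, (hCF F hF).2.trans hmono⟩⟩

theorem card_le_of_mem_flatChains [M.Finite] (hl : M.Loopless) (hne : M.E.Nonempty)
    (hC : C ∈ flatChains M) : C.card ≤ M.eRank.toNat - 1 := by
  classical
  have hE : M.E ∉ C := fun h => (hC.2 _ h).2.2 rfl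
  have hempty : ∅ ∉ insert M.E C := fun h =>
    (Finset.mem_insert.1 h).elim hne.ne_empty.symm fun h => (hC.2 _ h).2.1 rfl
  have hcard := card_le_of_isChain_isFlat (M := M) (C := insert ∅ (insert M.E C)) ?_ ?_
  · rw [Finset.card_insert_of_notMem hempty, Finset.card_insert_of_notMem hE] at hcard
    lia
  · rw [Finset.coe_insert, Finset.coe_insert]
    refine (hC.1.insert fun F hF _ => Or.inr (hC.2 F hF).1.subset_ground).insert fun F _ _ => ?_
    exact Or.inl (empty_subset F)
  · simp only [Finset.forall_mem_insert]
    exact ⟨isFlat_empty hl, M.ground_isFlat, fun F hF => (hC.2 F hF).1⟩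

theorem exists_mem_flatChains_le_card [M.Finite] :
    ∃ C ∈ flatChains M, M.eRank.toNat - 1 ≤ C.card := by
  classical
  obtain ⟨B, hB⟩ := M.exists_isBase
  lift B to Finset α using M.set_finite B hB.subset_ground
  obtain ⟨C, hC, hcard, hCF⟩ := exists_isChain_isFlat_card_eq B hB.indep
  have hsub : (C.erase ∅).erase M.E ⊆ C := (Finset.erase_subset _ _).trans (Finset.erase_subset _ _)
  refine ⟨(C.erase ∅).erase M.E, ⟨hC.mono (Finset.coe_subset.2 hsub), fun F hF => ?_⟩, ?_⟩
  · exact ⟨(hCF F (hsub hF)).1, Finset.ne_of_mem_erase (Finset.mem_of_mem_erase hF),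
      Finset.ne_of_mem_erase hF⟩
  · have h₁ := Finset.pred_card_le_card_erase (s := C) (a := ∅)
    have h₂ := Finset.pred_card_le_card_erase (s := C.erase ∅) (a := M.E)
    rw [← hB.encard_eq_eRank, ← ncard_def, ncard_coe_finset]
    lia

theorem maxFaceSize_flatChains [M.Finite] (hl : M.Loopless) (hne : M.E.Nonempty) :
    maxFaceSize (flatChains M) = M.eRank.toNat - 1 := by
  obtain ⟨C, hC, hcard⟩ := exists_mem_flatChains_le_card (M := M)
  refine le_antisymm (csSup_le ⟨_, mem_image_of_mem _ hC⟩ ?_)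
    (hcard.trans (card_le_maxFaceSize finite_flatChains hC))
  rintro _ ⟨D, hD, rfl⟩
  exact card_le_of_mem_flatChains hl hne hD

theorem fPolynomial_orderComplex_flats [M.Finite] (hl : M.Loopless) (hne : M.E.Nonempty) :
    fPolynomial (orderComplex (Flats M)) =
      ∑ᶠ C ∈ flatChains M, (X : ℤ[X]) ^ (M.eRank.toNat - 1 - C.card) := by
  rw [← fPolynomial_image_map _ (Function.Embedding.subtype M.IsFlat),
    image_map_orderComplex_flats hl, fPolynomial_eq_finsum finite_flatChains,
    maxFaceSize_flatChains hl hne]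

theorem chainPolynomial_eq_finsum (M : FinMatroid α) (hne : M.1.E.Nonempty) :
    chainPolynomial M = ∑ᶠ C, indicatorFun {N | N.Loopless ∧ C ∈ flatChains N} M.1 •
      (X : ℤ[X]) ^ (M.1.eRank.toNat - 1 - C.card) := by
  classical
  have := M.2
  rw [chainPolynomial]
  split_ifs with h
  · rw [fPolynomial_orderComplex_flats h.1 hne]
    refine finsum_congr fun C => ?_
    by_cases hC : C ∈ flatChains M.1 <;> simp [indicatorFun, hC, h.1]
  · have hl : ¬ M.1.Loopless := fun hl => h ⟨hl, hne⟩
    simp [indicatorFun, hl]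

end ChainsOfFlats

section Valuation

variable {α : Type*} {E : Finset α}

theorem isValuative_indicatorFun_mem_flatChains {ι : Type*} {M : ι → Matroid α}
    (hM : ∀ i, (M i).E = E) (C : Finset (Set α)) :
    IsValuative (fun i => basePolytope E (M i)) fun i =>
      indicatorFun {N | N.Loopless ∧ C ∈ flatChains N} (M i) := by
  by_cases hC : IsChain (· ⊆ ·) (C : Set (Set α)) ∧ ∀ F ∈ C, F ⊆ E ∧ F ≠ ∅ ∧ F ≠ E
  · have hiff : ∀ i, (chainFace E C (M i) ∩ {x | ∀ e, 0 < x e}).Nonempty ↔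
        M i ∈ {N : Matroid α | N.Loopless ∧ C ∈ flatChains N} := fun i => by
      rw [chainFace_inter_pos_nonempty_iff (hM i) hC.1 fun F hF => hM i ▸ (hC.2 F hF).1]
      refine and_congr_right fun _ => ⟨fun h => ⟨hC.1, fun F hF => ⟨h F hF, ?_⟩⟩,
        fun h F hF => (h.2 F hF).1⟩
      rw [hM i]
      exact (hC.2 F hF).2
    simpa only [indicatorFun_eq_eulerChar (hiff _)] using
      isValuative_eulerChar_chainFace_inter_pos hM C
  · have hnot : ∀ i, M i ∉ {N : Matroid α | N.Loopless ∧ C ∈ flatChains N} := by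
      refine fun i hi => hC ⟨hi.2.1, fun F hF => ?_⟩
      rw [← hM i]
      exact ⟨(hi.2.2 F hF).1.subset_ground, (hi.2.2 F hF).2⟩
    simpa only [indicatorFun, indicator_of_notMem (hnot _)] using IsValuative.zero _

theorem isValuative_chainPolynomial {ι : Type*} {M : ι → FinMatroid α}
    (hM : ∀ i, (M i).1.E = E) :
    IsValuative (fun i => basePolytope E (M i).1) fun i => chainPolynomial (M i) := by
  rcases E.eq_empty_or_nonempty with rfl | hE
  · have hzero : ∀ i, chainPolynomial (M i) = 0 := fun i => if_neg (by simp [hM i])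
    simpa only [hzero] using IsValuative.zero _
  have hne : ∀ i, (M i).1.E.Nonempty := fun i => hM i ▸ hE
  simp only [chainPolynomial_eq_finsum _ (hne _)]
  refine IsValuative.finsum (fun C => ?_) fun i => ?_
  · exact (isValuative_indicatorFun_mem_flatChains hM C).map_of_eq_of_inter_nonempty
      (ρ := fun i => (M i).1.eRank.toNat)
      (fun i j => toNat_eRank_eq_of_basePolytope_inter (hM i) (hM j))
      fun r => zmultiplesHom ℤ[X] (X ^ (r - 1 - C.card))
  · have := (M i).2
    refine (finite_flatChains (M := (M i).1)).subset fun C hC => of_not_not fun h => hC ?_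
    have hzero : indicatorFun {N : Matroid α | N.Loopless ∧ C ∈ flatChains N} (M i).1 = 0 :=
      indicator_of_notMem (fun hmem => h hmem.2) _
    simp only [hzero, zero_smul]

theorem isValuation_chainPolynomial (α : Type*) :
    IsValuation (chainPolynomial : FinMatroid α → ℤ[X]) := fun E => by
  have hrange : range (fun M : {M : FinMatroid α // M.1.E = E} => basePolytope E M.1.1) =
      basePolytopes E := by
    ext P
    constructor
    · rintro ⟨M, rfl⟩
      exact ⟨M.1.1, M.2, rfl⟩
    · rintro ⟨M, hM, rfl⟩
      exact ⟨⟨⟨M, ⟨hM ▸ E.finite_toSet⟩⟩, hM⟩, rfl⟩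
  obtain ⟨F, hF, hFM⟩ := (isValuative_chainPolynomial fun M => M.2).exists_isStrongValuation hrange
  exact ⟨F, hF, fun M hM => hFM ⟨M, hM⟩⟩

end Valuation

section Invariance

theorem map_mem_orderComplex {P Q : Type*} [PartialOrder P] [PartialOrder Q] (e : P ≃o Q)
    {C : Finset P} (hC : C ∈ orderComplex P) :
    C.map e.toEquiv.toEmbedding ∈ orderComplex Q := by
  refine ⟨?_, fun y hy => ?_⟩
  · rw [Finset.coe_map]
    rintro _ ⟨x, hx, rfl⟩ _ ⟨y, hy, rfl⟩ -
    exact (hC.1.total hx hy).imp (e.monotone ·) (e.monotone ·)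
  · obtain ⟨x, hx, rfl⟩ := Finset.mem_map.1 hy
    exact ⟨fun h => (hC.2 x hx).1 fun z => e.le_iff_le.1 (h (e z)),
      fun h => (hC.2 x hx).2 fun z => e.le_iff_le.1 (h (e z))⟩

theorem orderComplex_orderIso {P Q : Type*} [PartialOrder P] [PartialOrder Q] (e : P ≃o Q) :
    orderComplex Q = Finset.map e.toEquiv.toEmbedding '' orderComplex P := by
  ext C
  constructor
  · intro hC
    refine ⟨_, map_mem_orderComplex e.symm hC, ?_⟩
    ext x
    simp
  · rintro ⟨D, hD, rfl⟩
    exact map_mem_orderComplex e hD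

theorem exists_eq_map_of_isomorphic {α β : Type*} {M : Matroid α} {N : Matroid β}
    (h : Isomorphic M N) :
    ∃ (K : Matroid M.E) (f : M.E → α) (g : M.E → β) (hf : InjOn f K.E) (hg : InjOn g K.E),
      M = K.map f hf ∧ N = K.map g hg := by
  obtain ⟨e, he⟩ := h
  refine ⟨M.restrictSubtype M.E, Subtype.val, fun a => e a, Subtype.val_injective.injOn,
    (Subtype.val_injective.comp e.injective).injOn, M.map_val_restrictSubtype_ground_eq.symm,
    Matroid.ext_isBase ?_ fun B hB => ?_⟩
  · rw [Matroid.map_ground, Matroid.restrictSubtype_ground, image_univ]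
    exact (Subtype.range_coe.symm.trans (e.surjective.range_comp Subtype.val).symm)
  · have hbase : ∀ A, (M.restrictSubtype M.E).IsBase A ↔ N.IsBase ((fun a => (e a : β)) '' A) :=
      fun A => by rw [Matroid.restrictSubtype_ground_isBase_iff, he, image_image]
    simp only [Matroid.map_isBase_iff, hbase]
    refine ⟨fun hNB => ?_, fun ⟨_, hA, hAB⟩ => hAB ▸ hA⟩
    have himage : (fun a => (e a : β)) '' ((fun a => (e a : β)) ⁻¹' B) = B :=
      image_preimage_eq_of_subset fun b hb => ⟨e.symm ⟨b, hB hb⟩, by simp⟩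
    exact ⟨_, himage.symm ▸ hNB, himage.symm⟩

variable {α β : Type*}

theorem isFlat_map_image {M : Matroid α} {f : α → β} (hf : InjOn f M.E) {F : Set α}
    (hF : M.IsFlat F) : (M.map f hf).IsFlat (f '' F) := by
  rw [Matroid.isFlat_iff_closure_eq, Matroid.map_closure_eq, ← M.closure_inter_ground,
    hf.preimage_image_inter hF.subset_ground, hF.closure]

theorem exists_isFlat_image_eq {M : Matroid α} {f : α → β} (hf : InjOn f M.E) {G : Set β}
    (hG : (M.map f hf).IsFlat G) : ∃ F, M.IsFlat F ∧ f '' F = G :=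
  ⟨M.closure (f ⁻¹' G), M.isFlat_closure _, by rw [← Matroid.map_closure_eq M f hf, hG.closure]⟩

/-- The image of a matroid under an injection has an isomorphic lattice of flats. -/
noncomputable def flatsMap (M : Matroid α) (f : α → β) (hf : InjOn f M.E) :
    Flats M ≃o Flats (M.map f hf) :=
  RelIso.ofSurjective
    (OrderEmbedding.ofMapLEIff (fun F : Flats M =>
      (⟨f '' F.1, isFlat_map_image hf F.2⟩ : Flats (M.map f hf)))
      fun F G => hf.image_subset_image_iff F.2.subset_ground G.2.subset_ground)
    fun G => by
      obtain ⟨F, hF, hFG⟩ := exists_isFlat_image_eq hf G.2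
      exact ⟨⟨F, hF⟩, Subtype.ext hFG⟩

theorem map_loopless_iff (M : Matroid α) (f : α → β) (hf : InjOn f M.E) :
    (M.map f hf).Loopless ↔ M.Loopless := by
  rw [Matroid.loopless_iff, Matroid.loopless_iff, Matroid.map_loops, image_eq_empty]

theorem chainPolynomial_map (M : FinMatroid α) (N : FinMatroid β) (f : α → β) (hf : InjOn f M.1.E)
    (hN : N.1 = M.1.map f hf) : chainPolynomial N = chainPolynomial M := by
  obtain ⟨N, hNfin⟩ := N
  obtain rfl : N = M.1.map f hf := hN
  classical
  exact if_congr (and_congr (map_loopless_iff M.1 f hf) image_nonempty)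
    (by rw [orderComplex_orderIso (flatsMap M.1 f hf), fPolynomial_image_map]) rfl

theorem isInvariant_chainPolynomial (α : Type*) :
    IsInvariant (chainPolynomial : FinMatroid α → ℤ[X]) := fun M N h => by
  obtain ⟨K, f, g, hf, hg, hM, hN⟩ := exists_eq_map_of_isomorphic h
  have : Finite M.1.E := M.2.ground_finite
  have hK : K.Finite := ⟨K.E.toFinite⟩
  rw [chainPolynomial_map ⟨K, hK⟩ M f hf hM, chainPolynomial_map ⟨K, hK⟩ N g hg hN]

end Invariance

end ChainPoly

theorem theorem7p9 (α : Type*) :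
    ChainPoly.IsValuativeInvariant
      (ChainPoly.chainPolynomial : ChainPoly.FinMatroid α → Polynomial ℤ) := by
  exact ⟨ChainPoly.isInvariant_chainPolynomial α, ChainPoly.isValuation_chainPolynomial α⟩
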